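/- Fix an integer $k\ge 1$ and integers $r,c\ge 1$ with $r+c=k+1$, and let $R=(c^r)$ be the rectangle with $r$ rows and $c$ columns. Let $W$ be the affine symmetric group, that is, the group under composition of the bijections $w:\mathbb Z\to\mathbb Z$ with $w(i+k+1)=w(i)+k+1$ for all $i$ and $\sum_{i=1}^{k+1}w(i)=\binom{k+2}{2}$. For $i\in\mathbb Z/(k+1)$ let $s_i\in W$ be given by $s_i(j)=j+1$ if $j\equiv i$, $s_i(j)=j-1$ if $j\equiv i+1$, and $s_i(j)=j$ otherwise (mod $k+1$); the $s_i$ generate $W$. Let $\mathbb A$ be the affine nilCoxeter algebra over a commutative ring $K$: the associative unital $K$-algebra generated by $u_i$, $i\in\mathbb Z/(k+1)$, with relations $u_i^2=0$; $u_iu_j=u_ju_i$ if $i-j\ne\pm1$; and, if $k\ge2$, $u_iu_{i+1}u_i=u_{i+1}u_iu_{i+1}$. For $w\in W$ with reduced word $w=s_{i_1}\cdots s_{i_m}$ put $\mathbf u(w)=u_{i_1}\cdots u_{i_m}$. Let $V=\mathbb R^{k+1}/\mathbb R(1,\dots,1)$, with the left action $\diamond$ of $W$ for which $s_i$ ($1\le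 i\le k$) swaps the coordinates $a_i$ and $a_{i+1}$, and $s_0\diamond(a_1,\dots,a_{k+1})=(a_{k+1}+1,a_2,\dots,a_k,a_1-1)$. Let $A_\emptyset=\{a\in V: a_1\ge a_2\ge\cdots\ge a_{k+1}\ge a_1-1\}$ and $A_w=w^{-1}\diamond A_\emptyset$. Let $\Gamma\subset V$ be the set of classes of the vectors with entries in $\{0,1\}$ and coordinate sum $c$. For every $\gamma\in\Gamma$ there is a unique $z_\gamma\in W$ with $A_{z_\gamma}=A_\emptyset+\gamma$. Put $$Y_R=\sum_{\gamma\in\Gamma}\mathbf u(z_\gamma).$$ For a $c$-element subset $B$ of $[k+1]=\{1,\dots,k+1\}$ let $j_B\in W$ be the element with $j_B(i)=i-r$ for $i\in B$ and $j_B(i)=i+c$ for $i\in[k+1]\setminus B$. Put $$W_R=\sum_{B\in\binom{[k+1]}{c}}\mathbf u(j_B).$$ **Theorem.** For every $\gamma\in\Gamma$ the element $z_\gamma$ exists and is unique, and $Y_R=W_R$ in $\mathbb A$. -/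

import Mathlib

open scoped BigOperators

/-! ### The affine symmetric group -/

/-- A map `w : ℤ → ℤ` commuting with the translation by `k + 1`
commutes with its integer multiples. -/
theorem shift_mul {k : ℕ} {w : ℤ → ℤ} (hw : ∀ i : ℤ, w (i + (k + 1)) = w i + (k + 1))
    (i q : ℤ) : w (i + (k + 1) * q) = w i + (k + 1) * q := by
  induction q using Int.induction_on with
  | zero => simp
  | succ q ih =>
    have := hw (i + (k + 1) * q)
    rw [ih] at this
    rw [show i + ((k : ℤ) + 1) * (q + 1) = i + (k + 1) * q + (k + 1) by ring, this]
    ring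
  | pred q ih =>
    have := hw (i + (k + 1) * (-q - 1))
    rw [show i + ((k : ℤ) + 1) * (-q - 1) + (k + 1) = i + (k + 1) * (-q) by ring, ih] at this
    linarith

/-- The representative in `{1, …, k + 1}` of the class of `m` modulo `k + 1`. -/
def rep (k : ℕ) (m : ℤ) : ℤ := (m - 1) % (k + 1) + 1

theorem rep_mem (k : ℕ) (m : ℤ) : rep k m ∈ Finset.Icc (1 : ℤ) (k + 1) := by
  have h0 : (0 : ℤ) < k + 1 := by positivity
  have h1 := Int.emod_nonneg (m - 1) h0.ne'
  have h2 := Int.emod_lt_of_pos (m - 1) h0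
  simp only [Finset.mem_Icc, rep]
  omega

theorem rep_eq (k : ℕ) (m : ℤ) : rep k m = m + (k + 1) * (-((m - 1) / (k + 1))) := by
  have := Int.emod_add_mul_ediv (m - 1) ((k : ℤ) + 1)
  simp only [rep]
  linarith

theorem rep_shift (k : ℕ) (m q : ℤ) : rep k (m + (k + 1) * q) = rep k m := by
  simp only [rep]
  rw [show m + ((k : ℤ) + 1) * q - 1 = m - 1 + (k + 1) * q by ring, Int.add_mul_emod_self_left]

theorem rep_of_mem {k : ℕ} {m : ℤ} (hm : m ∈ Finset.Icc (1 : ℤ) (k + 1)) : rep k m = m := by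
  simp only [Finset.mem_Icc] at hm
  simp only [rep]
  rw [Int.emod_eq_of_lt] <;> omega

/-- A bijection commuting with the translation by `k + 1` permutes the residue classes,
so it preserves the sum over a period of a periodic function. -/
theorem sum_comp_periodic {k : ℕ} {w : Equiv.Perm ℤ}
    (hw : ∀ i : ℤ, w (i + (k + 1)) = w i + (k + 1)) {f : ℤ → ℤ}
    (hf : ∀ i q : ℤ, f (i + (k + 1) * q) = f i) :
    ∑ i ∈ Finset.Icc (1 : ℤ) (k + 1), f (w i) = ∑ i ∈ Finset.Icc (1 : ℤ) (k + 1), f i := by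
  have hw' : ∀ i : ℤ, w.symm (i + (k + 1)) = w.symm i + (k + 1) := fun i => by
    rw [Equiv.symm_apply_eq, hw, Equiv.apply_symm_apply]
  refine Finset.sum_nbij' (fun i => rep k (w i)) (fun i => rep k (w.symm i))
    (fun _ _ => rep_mem _ _) (fun _ _ => rep_mem _ _) ?_ ?_ ?_
  · intro i hi
    rw [rep_eq k (w i), shift_mul hw', Equiv.symm_apply_apply, rep_shift, rep_of_mem hi]
  · intro i hi
    rw [rep_eq k (w.symm i), shift_mul hw, Equiv.apply_symm_apply, rep_shift, rep_of_mem hi]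
  · intro i _
    rw [rep_eq k (w i), hf]

theorem sum_Icc_id (k : ℕ) :
    ∑ i ∈ Finset.Icc (1 : ℤ) (k + 1), i = ((k + 2).choose 2 : ℕ) := by
  induction k with
  | zero => simp
  | succ k ih =>
    have h : Finset.Icc (1 : ℤ) ((k + 1 : ℕ) + 1) =
        insert ((k : ℤ) + 2) (Finset.Icc (1 : ℤ) (k + 1)) := by
      ext x
      simp only [Finset.mem_Icc, Finset.mem_insert]
      push_cast
      omega
    rw [h, Finset.sum_insert (by simp), ih, show k + 1 + 2 = (k + 2) + 1 by ring,
      Nat.choose_succ_succ' (k + 2) 1]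
    push_cast
    simp

/-- The affine symmetric group `W` of type `A_k^{(1)}`: the group, under composition, of the
bijections `w` of `ℤ` such that `w (i + k + 1) = w i + k + 1` for all `i`, and
`w 1 + ⋯ + w (k + 1) = (k + 2).choose 2`. -/
def affineSymm (k : ℕ) : Subgroup (Equiv.Perm ℤ) where
  carrier := {w | (∀ i : ℤ, w (i + (k + 1)) = w i + (k + 1)) ∧
    ∑ i ∈ Finset.Icc (1 : ℤ) (k + 1), w i = ((k + 2).choose 2 : ℕ)}
  one_mem' := ⟨fun _ => rfl, sum_Icc_id k⟩
  mul_mem' := by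
    rintro v w ⟨hv, hv'⟩ ⟨hw, hw'⟩
    refine ⟨fun i => by simp [hv, hw], ?_⟩
    have h := sum_comp_periodic hw (f := fun i => v i - i)
      (fun i q => by rw [shift_mul hv]; ring)
    simp only [Finset.sum_sub_distrib, hv', hw', sum_Icc_id] at h
    simp only [Equiv.Perm.mul_apply]
    linarith
  inv_mem' := by
    rintro w ⟨hw, hw'⟩
    have hi : ∀ i : ℤ, w⁻¹ (i + (k + 1)) = w⁻¹ i + (k + 1) := fun i => by
      rw [Equiv.Perm.inv_eq_iff_eq, hw]
      simp
    refine ⟨hi, ?_⟩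
    have h := sum_comp_periodic hw (f := fun i => w⁻¹ i - i)
      (fun i q => by rw [shift_mul hi]; ring)
    simp only [Finset.sum_sub_distrib, hw', sum_Icc_id, Equiv.Perm.inv_def,
      Equiv.symm_apply_apply] at h
    simp only [Equiv.Perm.inv_def]
    linarith

theorem affineSymm_shift {k : ℕ} (w : affineSymm k) (i q : ℤ) :
    w.1 (i + (k + 1) * q) = w.1 i + (k + 1) * q := shift_mul w.2.1 i q

/-- The window `[w 1, …, w (k + 1)]` of `w`; the entry with index `i : Fin (k + 1)` is
`w (i + 1)`. -/
def window {k : ℕ} (w : affineSymm k) (i : Fin (k + 1)) : ℤ := w.1 ((i : ℤ) + 1)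

theorem window_injective (k : ℕ) : Function.Injective (window (k := k)) := by
  intro v w h
  apply Subtype.ext
  ext m
  have hm := rep_mem k m
  rw [Finset.mem_Icc] at hm
  have h1 := congrFun h ⟨(rep k m - 1).toNat, by omega⟩
  have h2 : (((rep k m - 1).toNat : ℕ) : ℤ) + 1 = rep k m := by omega
  simp only [window, h2] at h1
  rw [rep_eq, affineSymm_shift, affineSymm_shift] at h1
  linarith

/-- The map `j ↦ j + 1` if `j ≡ i`, `j ↦ j - 1` if `j ≡ i + 1`, and `j ↦ j` otherwise. -/
def simpleFun (k : ℕ) (i : ZMod (k + 1)) (j : ℤ) : ℤ :=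
  if (j : ZMod (k + 1)) = i then j + 1 else if (j : ZMod (k + 1)) = i + 1 then j - 1 else j

theorem zmod_one_ne_zero (k : ℕ) [NeZero k] : (1 : ZMod (k + 1)) ≠ 0 := by
  have : Fact (1 < k + 1) := ⟨by have := NeZero.pos k; omega⟩
  exact one_ne_zero

theorem simpleFun_involutive (k : ℕ) [NeZero k] (i : ZMod (k + 1)) :
    Function.Involutive (simpleFun k i) := by
  intro j
  have h1 := zmod_one_ne_zero k
  unfold simpleFun
  by_cases h : (j : ZMod (k + 1)) = i
  · simp [h, h1]
  · by_cases h' : (j : ZMod (k + 1)) = i + 1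
    · simp [h', h1]
    · simp [h, h']

theorem simpleFun_shift (k : ℕ) (i : ZMod (k + 1)) (j : ℤ) :
    simpleFun k i (j + (k + 1)) = simpleFun k i j + (k + 1) := by
  have h : ((j + (k + 1) : ℤ) : ZMod (k + 1)) = j := by
    have := ZMod.natCast_self (k + 1)
    push_cast at this ⊢
    rw [this, add_zero]
  unfold simpleFun
  rw [h]
  split_ifs <;> ring

/-- The generator `s_i` of `W`, for `i` an integer modulo `k + 1`. -/
def simpleRefl (k : ℕ) [NeZero k] (i : ZMod (k + 1)) : affineSymm k :=
  ⟨(simpleFun_involutive k i).toPerm, simpleFun_shift k i, by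
    let f : ℤ → ℤ := fun j => if (j : ZMod (k + 1)) = i + 1 then 1 else 0
    have hf : ∀ j q : ℤ, f (j + (k + 1) * q) = f j := fun j q => by
      have h : ((j + (k + 1) * q : ℤ) : ZMod (k + 1)) = j := by
        have := ZMod.natCast_self (k + 1)
        push_cast at this ⊢
        rw [this, zero_mul, add_zero]
      simp only [f, h]
    have h := sum_comp_periodic (k := k) (w := Equiv.addRight 1)
      (fun j => by simp only [Equiv.coe_addRight]; ring) hf
    have h1 := zmod_one_ne_zero k
    have h2 : ∀ j : ℤ, simpleFun k i j = f (j + 1) - f j + j := fun j => by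
      simp only [f, simpleFun, Int.cast_add, Int.cast_one, add_left_inj]
      by_cases h : (j : ZMod (k + 1)) = i
      · simp [h, h1]; ring
      · by_cases h' : (j : ZMod (k + 1)) = i + 1
        · simp [h', h1]; ring
        · simp [h, h']
    simp only [Function.Involutive.coe_toPerm, h2, Finset.sum_add_distrib,
      Finset.sum_sub_distrib, sum_Icc_id]
    simp only [Equiv.coe_addRight] at h
    rw [h]; ring⟩

/-- The element `s_{i₁} s_{i₂} ⋯ s_{i_m}` of `W`. -/
def wordProd {k : ℕ} [NeZero k] (l : List (ZMod (k + 1))) : affineSymm k :=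
  (l.map (simpleRefl k)).prod

/-- The word `l` is a reduced word for `w`: it is a word for `w` of minimal length. -/
def IsReducedWord {k : ℕ} [NeZero k] (w : affineSymm k) (l : List (ZMod (k + 1))) : Prop :=
  wordProd l = w ∧ ∀ l' : List (ZMod (k + 1)), wordProd l' = w → l.length ≤ l'.length

theorem intCast_eq_iff {k : ℕ} (i j : ℤ) :
    (i : ZMod (k + 1)) = j ↔ ∃ q : ℤ, i = j + (k + 1) * q := by
  rw [eq_comm, ZMod.intCast_eq_intCast_iff_dvd_sub]
  constructor
  · rintro ⟨q, hq⟩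
    exact ⟨q, by push_cast at hq; linarith⟩
  · rintro ⟨q, hq⟩
    exact ⟨q, by push_cast; linarith⟩

theorem sum_residue {k : ℕ} (b : ℤ) {h : ℤ → ℤ} (hh : ∀ i q : ℤ, h (i + (k + 1) * q) = h i) :
    ∑ j ∈ Finset.Icc (1 : ℤ) (k + 1), (if (j : ZMod (k + 1)) = b then h j else 0) = h b := by
  rw [Finset.sum_eq_single (rep k b)]
  · rw [if_pos ((intCast_eq_iff _ _).2 ⟨_, rep_eq k b⟩), rep_eq, hh]
  · intro j hj hne
    rw [if_neg]
    intro hjb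
    obtain ⟨q, rfl⟩ := (intCast_eq_iff _ _).1 hjb
    rw [← rep_of_mem hj, rep_shift] at hne
    exact hne rfl
  · exact fun h => absurd (rep_mem k b) h

/-- The effect of right multiplication by a generator on the sum of the `(w j - j) ^ 2`. -/
theorem sum_sq_mul_simpleRefl {k : ℕ} [NeZero k] (w : affineSymm k) (a : ℤ) :
    ∑ j ∈ Finset.Icc (1 : ℤ) (k + 1), ((w * simpleRefl k a).1 j - j) ^ 2 =
      ∑ j ∈ Finset.Icc (1 : ℤ) (k + 1), (w.1 j - j) ^ 2 + 2 * (w.1 (a + 1) - w.1 a) := by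
  have h1 := zmod_one_ne_zero k
  have hD : ∀ i q : ℤ, w.1 (i + (k + 1) * q) - (i + (k + 1) * q) = w.1 i - i := fun i q => by
    rw [affineSymm_shift]; ring
  have hss : ∀ j : ℤ, (simpleRefl k a).1 ((simpleRefl k a).1 j) = j :=
    simpleFun_involutive k a
  rw [← sum_comp_periodic (simpleRefl k a).2.1
    (f := fun j => ((w * simpleRefl k a).1 j - j) ^ 2)
    (fun i q => by rw [affineSymm_shift]; ring)]
  have key : ∀ j : ℤ, ((w * simpleRefl k a).1 ((simpleRefl k a).1 j) - (simpleRefl k a).1 j) ^ 2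
      = (w.1 j - j) ^ 2 + (if (j : ZMod (k + 1)) = (a : ℤ) then (1 - 2 * (w.1 j - j)) else 0)
        + (if (j : ZMod (k + 1)) = (a + 1 : ℤ) then (1 + 2 * (w.1 j - j)) else 0) := fun j => by
    have h2 : (w * simpleRefl k a).1 ((simpleRefl k a).1 j) = w.1 j :=
      congrArg w.1 (hss j)
    have h3 : (simpleRefl k a).1 j = simpleFun k a j := rfl
    rw [h2, h3, simpleFun, Int.cast_add, Int.cast_one]
    by_cases h : (j : ZMod (k + 1)) = a
    · simp [h, h1]; ring
    · by_cases h' : (j : ZMod (k + 1)) = a + 1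
      · simp [h', h1]; ring
      · simp [h, h']
  simp only [key, Finset.sum_add_distrib]
  rw [sum_residue a (h := fun j => 1 - 2 * (w.1 j - j)) (fun i q => by simp only [hD]),
    sum_residue (a + 1) (h := fun j => 1 + 2 * (w.1 j - j)) (fun i q => by simp only [hD])]
  ring

/-- The generators generate `W`. -/
theorem exists_word {k : ℕ} [NeZero k] (w : affineSymm k) :
    ∃ l : List (ZMod (k + 1)), wordProd l = w := by
  induction h : (∑ j ∈ Finset.Icc (1 : ℤ) (k + 1), (w.1 j - j) ^ 2).toNat using
    Nat.strong_induction_on generalizing w with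
  | _ N ih =>
    by_cases hd : ∃ a : ℤ, w.1 (a + 1) < w.1 a
    · obtain ⟨a, ha⟩ := hd
      have h0 := sum_sq_mul_simpleRefl w a
      have h1 : 0 ≤ ∑ j ∈ Finset.Icc (1 : ℤ) (k + 1), ((w * simpleRefl k a).1 j - j) ^ 2 :=
        Finset.sum_nonneg fun _ _ => sq_nonneg _
      obtain ⟨l, hl⟩ := ih _ (by omega) (w * simpleRefl k a) rfl
      refine ⟨l ++ [(a : ZMod (k + 1))], ?_⟩
      have h2 : simpleRefl k a * simpleRefl k a = 1 :=
        Subtype.ext (Equiv.ext (simpleFun_involutive k a))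
      rw [wordProd, List.map_append, List.prod_append, ← wordProd, hl]
      simp [mul_assoc, h2]
    · push Not at hd
      have hm : StrictMono w.1 := strictMono_int_of_lt_succ fun a =>
        lt_of_le_of_ne (hd a) fun h => by simpa using w.1.injective h
      have hs : ∀ a : ℤ, w.1 (a + 1) = w.1 a + 1 := fun a => by
        by_contra hne
        have h1 : w.1 a < w.1 (a + 1) := hm (by omega)
        obtain ⟨b, hb⟩ := w.1.surjective (w.1 a + 1)
        have h2 : a < b := hm.lt_iff_lt.mp (by omega)
        have h3 : b < a + 1 := hm.lt_iff_lt.mp (by omega)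
        omega
      have ht : ∀ a : ℤ, w.1 a = w.1 0 + a := fun a => by
        induction a using Int.induction_on with
        | zero => simp
        | succ a ih => rw [hs, ih]; ring
        | pred a ih =>
          have := hs (-a - 1)
          rw [sub_add_cancel, ih] at this
          omega
      have hsum := w.2.2
      rw [Finset.sum_congr rfl fun a _ => ht a, Finset.sum_add_distrib, sum_Icc_id,
        Finset.sum_const, Int.card_Icc] at hsum
      have h0 : w.1 0 = 0 := by
        have h4 : ((k : ℤ) + 1 + 1 - 1).toNat = k + 1 := by omega
        rw [h4, add_eq_right, smul_eq_zero] at hsum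
        exact hsum.resolve_left (Nat.succ_ne_zero k)
      exact ⟨[], Subtype.ext (Equiv.ext fun a => by
        rw [ht a, h0, zero_add]; simp [wordProd])⟩

theorem exists_isReducedWord {k : ℕ} [NeZero k] (w : affineSymm k) :
    ∃ l : List (ZMod (k + 1)), IsReducedWord w l := by
  classical
  have h : ∃ m : ℕ, ∃ l : List (ZMod (k + 1)), wordProd l = w ∧ l.length = m := by
    obtain ⟨l, hl⟩ := exists_word w
    exact ⟨_, l, hl, rfl⟩
  obtain ⟨l, hl, hlen⟩ := Nat.find_spec h
  exact ⟨l, hl, fun l' hl' => hlen ▸ Nat.find_min' h ⟨l', hl', rfl⟩⟩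

/-! ### The affine nilCoxeter algebra -/

/-- The defining relations of the affine nilCoxeter algebra; subscripts are modulo `k + 1`.
As usual the braid relation between `u_i` and `u_{i+1}` is absent for `k = 1`, where
`s_0 s_1` has infinite order. -/
inductive NilCoxeterRel (K : Type*) [CommRing K] (k : ℕ) :
    FreeAlgebra K (ZMod (k + 1)) → FreeAlgebra K (ZMod (k + 1)) → Prop
  | sq (i : ZMod (k + 1)) :
      NilCoxeterRel K k (FreeAlgebra.ι K i * FreeAlgebra.ι K i) 0
  | comm (i j : ZMod (k + 1)) (h : i - j ≠ 1) (h' : i - j ≠ -1) :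
      NilCoxeterRel K k (FreeAlgebra.ι K i * FreeAlgebra.ι K j)
        (FreeAlgebra.ι K j * FreeAlgebra.ι K i)
  | braid (i : ZMod (k + 1)) (hk : 2 ≤ k) :
      NilCoxeterRel K k
        (FreeAlgebra.ι K i * FreeAlgebra.ι K (i + 1) * FreeAlgebra.ι K i)
        (FreeAlgebra.ι K (i + 1) * FreeAlgebra.ι K i * FreeAlgebra.ι K (i + 1))

/-- The affine nilCoxeter algebra over the commutative ring `K`. -/
abbrev NilCoxeter (K : Type*) [CommRing K] (k : ℕ) : Type _ := RingQuot (NilCoxeterRel K k)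

/-- The generator `u_i` of the affine nilCoxeter algebra. -/
def nilGen (K : Type*) [CommRing K] (k : ℕ) (i : ZMod (k + 1)) : NilCoxeter K k :=
  RingQuot.mkAlgHom K (NilCoxeterRel K k) (FreeAlgebra.ι K i)

/-- The standard basis element `𝐮(w) = u_{i₁} ⋯ u_{i_m}`, where `s_{i₁} ⋯ s_{i_m}` is a reduced
word for `w`. (Any two reduced words are related by braid and commutation moves, so the product
does not depend on the reduced word.) -/
noncomputable def nilBasis (K : Type*) [CommRing K] {k : ℕ} [NeZero k] (w : affineSymm k) :
    NilCoxeter K k :=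
  ((exists_isReducedWord w).choose.map (nilGen K k)).prod

/-! ### The action on alcoves and the element `Y_R` -/

/-- The space `V`, the quotient of `ℝ^{k+1}` by the line spanned by `(1, …, 1)`. The coordinate
`a_{i+1}` of `a` is `a i`, for `i : Fin (k + 1)`. -/
abbrev AlcoveSpace (k : ℕ) : Type :=
  (Fin (k + 1) → ℝ) ⧸ Submodule.span ℝ {(fun _ => 1 : Fin (k + 1) → ℝ)}

/-- The class in `V` of a vector of `ℝ^{k+1}`. -/
def toV {k : ℕ} (a : Fin (k + 1) → ℝ) : AlcoveSpace k := Submodule.Quotient.mk a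

/-- The extension of `(a_1, …, a_{k+1})` to a sequence indexed by `ℤ`
with `a_{j+k+1} = a_j - 1`. -/
noncomputable def seqExtend {k : ℕ} (a : Fin (k + 1) → ℝ) (j : ℤ) : ℝ :=
  a (Fin.ofNat (k + 1) ((j - 1) % (k + 1)).toNat) - ((j - 1) / (k + 1) : ℤ)

theorem seqExtend_shift {k : ℕ} (a : Fin (k + 1) → ℝ) (j q : ℤ) :
    seqExtend a (j + (k + 1) * q) = seqExtend a j - q := by
  have h0 : (k : ℤ) + 1 ≠ 0 := by positivity
  unfold seqExtend
  rw [show j + ((k : ℤ) + 1) * q - 1 = j - 1 + (k + 1) * q by ring, Int.add_mul_emod_self_left,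
    Int.add_mul_ediv_left _ _ h0]
  push_cast
  ring

theorem seqExtend_coe {k : ℕ} (a : Fin (k + 1) → ℝ) (i : Fin (k + 1)) :
    seqExtend a ((i : ℤ) + 1) = a i := by
  have h1 : ((i : ℤ) + 1 - 1) % (k + 1) = i := by
    rw [add_sub_cancel_right, Int.emod_eq_of_lt] <;> omega
  have h2 : ((i : ℤ) + 1 - 1) / (k + 1) = 0 := by
    rw [add_sub_cancel_right, Int.ediv_eq_zero_of_lt] <;> omega
  unfold seqExtend
  rw [h1, h2]
  simp

theorem seqExtend_ext {k : ℕ} {f : ℤ → ℝ} {a : Fin (k + 1) → ℝ}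
    (hf : ∀ j q : ℤ, f (j + (k + 1) * q) = f j - q) (h : ∀ i : Fin (k + 1), f ((i : ℤ) + 1) = a i) :
    seqExtend a = f := by
  funext j
  have hm := rep_mem k j
  rw [Finset.mem_Icc] at hm
  have h2 : (((rep k j - 1).toNat : ℕ) : ℤ) + 1 = rep k j := by omega
  have h1 := h ⟨(rep k j - 1).toNat, by omega⟩
  rw [← seqExtend_coe a] at h1
  simp only [h2] at h1
  rw [rep_eq, hf, seqExtend_shift] at h1
  linarith

/-- The left action of `W` on `ℝ^{k+1}`: `w` permutes the places of the extended sequence. -/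
noncomputable def diamond {k : ℕ} (w : affineSymm k) (a : Fin (k + 1) → ℝ) : Fin (k + 1) → ℝ :=
  fun i => seqExtend a (w⁻¹.1 ((i : ℤ) + 1))

theorem seqExtend_diamond {k : ℕ} (w : affineSymm k) (a : Fin (k + 1) → ℝ) (j : ℤ) :
    seqExtend (diamond w a) j = seqExtend a (w⁻¹.1 j) :=
  congrFun (seqExtend_ext (f := fun j => seqExtend a (w⁻¹.1 j))
    (fun j q => by simp only [affineSymm_shift, seqExtend_shift]) fun _ => rfl) j

theorem diamond_one {k : ℕ} (a : Fin (k + 1) → ℝ) : diamond 1 a = a :=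
  funext fun i => by simp [diamond, seqExtend_coe]

theorem diamond_mul {k : ℕ} (v w : affineSymm k) (a : Fin (k + 1) → ℝ) :
    diamond (v * w) a = diamond v (diamond w a) :=
  funext fun i => by
    conv_rhs => rw [diamond, seqExtend_diamond]
    simp [diamond, mul_inv_rev]

theorem simpleRefl_inv {k : ℕ} [NeZero k] (i : ZMod (k + 1)) :
    (simpleRefl k i)⁻¹ = simpleRefl k i :=
  inv_eq_of_mul_eq_one_left (Subtype.ext (Equiv.ext (simpleFun_involutive k i)))

/-- For `1 ≤ i ≤ k`, the generator `s_i` swaps the coordinates `a_i` and `a_{i+1}`. -/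
theorem diamond_simpleRefl {k : ℕ} [NeZero k] (a : Fin (k + 1) → ℝ) (i : Fin k) :
    diamond (simpleRefl k (((i : ℕ) + 1 : ℕ) : ZMod (k + 1))) a =
      a ∘ Equiv.swap i.castSucc i.succ := by
  funext j
  have hi := i.2
  have hj := j.2
  have h : ∀ m : ℕ, m ≤ k + 1 → 0 < m →
      ((((j : ℤ) + 1 : ℤ) : ZMod (k + 1)) = (m : ZMod (k + 1)) ↔ (j : ℕ) + 1 = m) := by
    intro m hm hm0
    rw [← Int.cast_natCast (R := ZMod (k + 1)) m, intCast_eq_iff]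
    constructor
    · rintro ⟨q, hq⟩
      have : q = 0 := by nlinarith
      subst this
      omega
    · rintro rfl
      exact ⟨0, by push_cast; ring⟩
  rw [diamond, simpleRefl_inv]
  change seqExtend a (simpleFun k _ _) = _
  have h1 := h (i + 1) (by omega) (by omega)
  have h2 := h (i + 1 + 1) (by omega) (by omega)
  rw [Nat.cast_add (_ + _) 1, Nat.cast_one] at h2
  simp only [simpleFun, h1, h2, Function.comp_apply]
  split_ifs with h3 h4
  · have h5 : j = i.castSucc := Fin.ext (by simpa using h3)
    have h6 : ((j : ℤ) + 1 + 1) = ((i.succ : Fin (k + 1)) : ℕ) + 1 := by rw [h5]; simp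
    rw [h6, seqExtend_coe, h5, Equiv.swap_apply_left]
  · have h5 : j = i.succ := Fin.ext (by simpa using h4)
    have h6 : ((j : ℤ) + 1 - 1) = ((i.castSucc : Fin (k + 1)) : ℕ) + 1 := by rw [h5]; simp
    rw [h6, seqExtend_coe, h5, Equiv.swap_apply_right]
  · rw [seqExtend_coe, Equiv.swap_apply_of_ne_of_ne]
    · rintro rfl; simp at h3
    · rintro rfl; simp at h4

/-- The generator `s_0` maps `(a_1, …, a_{k+1})` to `(a_{k+1} + 1, a_2, …, a_k, a_1 - 1)`. -/
theorem diamond_simpleRefl_zero {k : ℕ} [NeZero k] (a : Fin (k + 1) → ℝ) :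
    diamond (simpleRefl k 0) a =
      Function.update (Function.update a 0 (a (Fin.last k) + 1)) (Fin.last k) (a 0 - 1) := by
  funext j
  have hk := NeZero.pos k
  have hj := j.2
  have h1 : (((j : ℤ) + 1 : ℤ) : ZMod (k + 1)) = 0 ↔ j = Fin.last k := by
    rw [← Int.cast_zero, intCast_eq_iff, Fin.ext_iff, Fin.val_last]
    constructor
    · rintro ⟨q, hq⟩
      have : q = 1 := by nlinarith
      subst this
      omega
    · intro h
      exact ⟨1, by rw [h]; ring⟩
  have h2 : (((j : ℤ) + 1 : ℤ) : ZMod (k + 1)) = 0 + 1 ↔ j = 0 := by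
    rw [zero_add, ← Int.cast_one (R := ZMod (k + 1)), intCast_eq_iff, Fin.ext_iff, Fin.val_zero]
    constructor
    · rintro ⟨q, hq⟩
      have : q = 0 := by nlinarith
      subst this
      omega
    · intro h
      exact ⟨0, by rw [h]; simp⟩
  rw [diamond, simpleRefl_inv]
  change seqExtend a (simpleFun k _ _) = _
  simp only [simpleFun, h1, h2]
  split_ifs with h3 h4
  · have h6 : ((j : ℤ) + 1 + 1) = ((0 : Fin (k + 1)) : ℕ) + 1 + (k + 1) * 1 := by
      rw [h3]; simp; ring
    rw [h6, seqExtend_shift, seqExtend_coe, h3, Function.update_self]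
    simp
  · have h6 : ((j : ℤ) + 1 - 1) = ((Fin.last k : Fin (k + 1)) : ℕ) + 1 + (k + 1) * (-1) := by
      rw [h4]; simp
    rw [h6, seqExtend_shift, seqExtend_coe, Function.update_of_ne h3, h4, Function.update_self]
    simp
  · rw [seqExtend_coe, Function.update_of_ne h3, Function.update_of_ne h4]

theorem diamond_add_const {k : ℕ} (w : affineSymm k) (a : Fin (k + 1) → ℝ) (t : ℝ) :
    diamond w (a + fun _ => t) = diamond w a + fun _ => t :=
  funext fun i => by simp only [diamond, seqExtend, Pi.add_apply]; ring

theorem toV_eq_iff {k : ℕ} (a b : Fin (k + 1) → ℝ) :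
    toV a = toV b ↔ ∃ t : ℝ, a = b + fun _ => t := by
  rw [toV, toV, Submodule.Quotient.eq, Submodule.mem_span_singleton]
  constructor
  · rintro ⟨t, ht⟩
    refine ⟨t, ?_⟩
    rw [eq_comm, ← eq_sub_iff_add_eq', ← ht]
    funext i
    simp
  · rintro ⟨t, rfl⟩
    exact ⟨t, funext fun i => by simp⟩

/-- The action `w ⋄ v` of `W` on `V`. -/
noncomputable instance (k : ℕ) : MulAction (affineSymm k) (AlcoveSpace k) where
  smul w := Quotient.lift (fun a => toV (diamond w a)) fun a b hab => by
    obtain ⟨t, rfl⟩ := (toV_eq_iff a b).1 (Quotient.sound hab)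
    exact (toV_eq_iff _ _).2 ⟨t, diamond_add_const w b t⟩
  one_smul v := by
    induction v using Quotient.inductionOn with
    | h a => exact congrArg toV (diamond_one a)
  mul_smul v w x := by
    induction x using Quotient.inductionOn with
    | h a => exact congrArg toV (diamond_mul v w a)

theorem smul_toV {k : ℕ} (w : affineSymm k) (a : Fin (k + 1) → ℝ) :
    w • toV a = toV (diamond w a) := rfl

/-- The fundamental alcove: the `a` with `a_1 ≥ a_2 ≥ ⋯ ≥ a_{k+1} ≥ a_1 - 1`. -/
def fundAlcove (k : ℕ) : Set (AlcoveSpace k) :=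
  toV '' {a | Antitone a ∧ a 0 - 1 ≤ a (Fin.last k)}

/-- The alcove `A_w = w⁻¹ ⋄ A_∅`. -/
def alcove {k : ℕ} (w : affineSymm k) : Set (AlcoveSpace k) :=
  (fun v => w⁻¹ • v) '' fundAlcove k

/-- `y` is a pseudo-translation of `A_w` in direction `η`, that is, `A_{yw} = A_w + η`. -/
def IsPseudoTranslation {k : ℕ} (y w : affineSymm k) (η : AlcoveSpace k) : Prop :=
  alcove (y * w) = (fun v => v + η) '' alcove w

/-- The set `Γ` of the classes in `V` of the `0`-`1` vectors with coordinate sum `c`. -/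
noncomputable def Gam (k c : ℕ) : Finset (AlcoveSpace k) :=
  open Classical in
  ((Fintype.piFinset fun _ : Fin (k + 1) => ({0, 1} : Finset ℝ)).filter
    fun a => ∑ i, a i = (c : ℝ)).image toV

/-- The pseudo-translation `z_γ` of the fundamental alcove in direction `γ`. -/
noncomputable def zElt {k : ℕ} (γ : AlcoveSpace k) : affineSymm k :=
  Classical.epsilon fun y => IsPseudoTranslation y 1 γ

/-- `Y_R = ∑_{γ ∈ Γ} 𝐮(z_γ)` for the rectangle `R` with `c` columns and `k + 1 - c` rows. -/
noncomputable def yRect (K : Type*) [CommRing K] (k c : ℕ) [NeZero k] : NilCoxeter K k :=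
  ∑ γ ∈ Gam k c, nilBasis K (zElt γ)

/-! ### Windows and the element `W_R` -/

/-- The map `i ↦ i - r` if the class of `i` modulo `k + 1` has a representative in `B`, and
`i ↦ i + c` otherwise; here `i : Fin (k + 1)` in `B` stands for the element `i + 1` of
`{1, …, k + 1}`. -/
def jFun {k : ℕ} (r c : ℕ) (B : Finset (Fin (k + 1))) (m : ℤ) : ℤ :=
  if Fin.ofNat (k + 1) (rep k m - 1).toNat ∈ B then m - r else m + c

theorem jFun_coe {k : ℕ} (r c : ℕ) (B : Finset (Fin (k + 1))) (i : Fin (k + 1)) :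
    jFun r c B ((i : ℤ) + 1) = if i ∈ B then (i : ℤ) + 1 - r else (i : ℤ) + 1 + c := by
  rw [jFun, rep_of_mem (by rw [Finset.mem_Icc]; omega)]
  simp

theorem jFun_shift {k : ℕ} (r c : ℕ) (B : Finset (Fin (k + 1))) (m q : ℤ) :
    jFun r c B (m + (k + 1) * q) = jFun r c B m + (k + 1) * q := by
  unfold jFun
  rw [rep_shift]
  split_ifs <;> ring

theorem jFun_mod {k r c : ℕ} (h : r + c = k + 1) (B : Finset (Fin (k + 1))) (m : ℤ) :
    ∃ q : ℤ, jFun r c B m = m + c + (k + 1) * q := by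
  have hr : (r : ℤ) + c = k + 1 := by exact_mod_cast h
  unfold jFun
  split_ifs
  · exact ⟨-1, by linarith⟩
  · exact ⟨0, by ring⟩

theorem sum_Icc_fin (k : ℕ) (f : ℤ → ℤ) :
    ∑ i ∈ Finset.Icc (1 : ℤ) (k + 1), f i = ∑ i : Fin (k + 1), f ((i : ℤ) + 1) := by
  symm
  refine Finset.sum_bij (fun i _ => (i : ℤ) + 1) ?_ ?_ ?_ ?_
  · intro i _
    rw [Finset.mem_Icc]
    omega
  · intro i _ j _ h
    ext
    simpa using h
  · intro j hj
    rw [Finset.mem_Icc] at hj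
    exact ⟨⟨(j - 1).toNat, by omega⟩, Finset.mem_univ _, by simp only; omega⟩
  · exact fun _ _ => rfl

/-- The element `j_B` of `W`, for a `c`-element subset `B` of `{1, …, k + 1}`. -/
def jElt {k r c : ℕ} (h : r + c = k + 1) (B : {B : Finset (Fin (k + 1)) // B.card = c}) :
    affineSymm k :=
  ⟨{ toFun := jFun r c B.1
     invFun := fun m => m - c + (m - jFun r c B.1 (m - c))
     left_inv := fun m => by
       rcases jFun_mod h B.1 m with ⟨q, hq⟩
       have h1 : jFun r c B.1 m - c = m + (k + 1) * q := by rw [hq]; ring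
       simp only [h1, jFun_shift]
       linarith
     right_inv := fun m => by
       rcases jFun_mod h B.1 (m - c) with ⟨q, hq⟩
       have h1 : m - c + (m - jFun r c B.1 (m - c)) = m - c + (k + 1) * (-q) := by
         rw [hq]; ring
       simp only [h1, jFun_shift]
       rw [hq]; ring },
    fun i => by simpa using jFun_shift r c B.1 i 1, by
    have hr : (r : ℤ) + c = k + 1 := by exact_mod_cast h
    have h1 : ∀ i : Fin (k + 1), jFun r c B.1 ((i : ℤ) + 1) =
        ((i : ℤ) + 1) + c + (if i ∈ B.1 then -((k : ℤ) + 1) else 0) := fun i => by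
      rw [jFun_coe]
      split_ifs <;> linarith
    rw [← sum_Icc_id k, sum_Icc_fin, sum_Icc_fin]
    simp only [Equiv.coe_fn_mk, h1, Finset.sum_add_distrib, Finset.sum_ite_mem,
      Finset.univ_inter, Finset.sum_const, B.2, Finset.card_univ, Fintype.card_fin,
      nsmul_eq_mul]
    push_cast
    ring⟩

/-- The window of `j_B` has the entries `i - r` for `i ∈ B` and `i + c` for `i ∉ B`. -/
theorem window_jElt {k r c : ℕ} (h : r + c = k + 1)
    (B : {B : Finset (Fin (k + 1)) // B.card = c}) (i : Fin (k + 1)) :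
    window (jElt h B) i = if i ∈ B.1 then (i : ℤ) + 1 - r else (i : ℤ) + 1 + c :=
  jFun_coe r c B.1 i

/-- `W_R = ∑_B 𝐮(j_B)` for the rectangle `R = (c^r)`, where `B` runs over the `c`-element subsets
of `{1, …, k + 1}`. -/
noncomputable def wRect (K : Type*) [CommRing K] {k r c : ℕ} [NeZero k] (h : r + c = k + 1) :
    NilCoxeter K k :=
  ∑ B : {B : Finset (Fin (k + 1)) // B.card = c}, nilBasis K (jElt h B)

/-!
Identify a point `a` of `ℝ^{k+1}` with its extension to a sequence on `ℤ` with
`a_{j+k+1} = a_j - 1`. In these terms `W` acts by permuting the places, and the class of `a` lies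
in `A_∅` exactly when the sequence is antitone (`toV_mem_fundAlcove`); hence it lies in `A_w`
exactly when `j ↦ a_{w⁻¹ j}` is antitone (`toV_mem_alcove`).

Let `γ` be the class of the indicator vector of a `c`-element set `B`. Subtracting `1` from the
entry at place `j` amounts to reading the sequence at place `j + (k + 1)`, and
`j_B (j + (k + 1)) = j + c` for `j ∈ B`, while `j_B j = j + c` for `j ∉ B`. So the sequence of
`a - γ` is the sequence `j ↦ a_{j_B⁻¹ j}` moved by `c` places (`seqExtend_sub_indicator`). Moving
the places does not affect antitonicity, so `A_{j_B} = A_∅ + γ`: the element `z_γ` is `j_B`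
itself. It is unique since an element of `W` taking a strictly decreasing sequence to an antitone
one is increasing on `ℤ`, hence trivial (`alcove_injective`). As `B ↦ γ` is a bijection onto `Γ`, the
sums `Y_R` and `W_R` agree term by term.
-/

/-- An increasing element of `W` is trivial: `w j - j` is then monotone and periodic, hence
constant, and its sum over a period vanishes. -/
theorem eq_one_of_monotone {k : ℕ} (w : affineSymm k) (hw : Monotone w.1) : w = 1 := by
  have hD : Monotone fun j => w.1 j - j := monotone_int_of_le_succ fun j => by
    have : w.1 j < w.1 (j + 1) :=
      lt_of_le_of_ne (hw (by omega)) fun h => by simpa using w.1.injective h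
    omega
  have hp : ∀ q : ℤ, w.1 ((k + 1) * q) - (k + 1) * q = w.1 0 := fun q => by
    have := affineSymm_shift w 0 q
    rw [zero_add] at this
    rw [this]
    ring
  have hc : ∀ j : ℤ, w.1 j = w.1 0 + j := fun j => by
    have h1 : w.1 j - j ≤ w.1 ((k + 1) * |j|) - (k + 1) * |j| :=
      hD (by nlinarith [le_abs_self j, abs_nonneg j])
    have h2 : w.1 ((k + 1) * -|j|) - (k + 1) * -|j| ≤ w.1 j - j :=
      hD (by nlinarith [neg_abs_le j, abs_nonneg j])
    rw [hp] at h1 h2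
    omega
  have hsum := w.2.2
  rw [Finset.sum_congr rfl fun a _ => hc a, Finset.sum_add_distrib, sum_Icc_id,
    Finset.sum_const, Int.card_Icc, show ((k : ℤ) + 1 + 1 - 1).toNat = k + 1 by omega,
    add_eq_right, smul_eq_zero] at hsum
  have h0 := hsum.resolve_left (Nat.succ_ne_zero k)
  exact Subtype.ext (Equiv.ext fun j => by rw [hc j, h0, zero_add]; rfl)

theorem seqExtend_add_const {k : ℕ} (a : Fin (k + 1) → ℝ) (t : ℝ) (j : ℤ) :
    seqExtend (a + fun _ => t) j = seqExtend a j + t := by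
  simp only [seqExtend, Pi.add_apply]
  ring

theorem antitone_seqExtend_iff {k : ℕ} (a : Fin (k + 1) → ℝ) :
    Antitone (seqExtend a) ↔ Antitone a ∧ a 0 - 1 ≤ a (Fin.last k) := by
  constructor
  · intro h
    refine ⟨fun i j hij => ?_, ?_⟩
    · rw [← seqExtend_coe a i, ← seqExtend_coe a j]
      exact h (by have := Fin.le_def.1 hij; omega)
    · have h1 := seqExtend_shift a (((0 : Fin (k + 1)) : ℕ) + 1) 1
      rw [seqExtend_coe] at h1
      rw [← seqExtend_coe a (Fin.last k)]
      have h2 := h (show (((Fin.last k : Fin (k + 1)) : ℕ) : ℤ) + 1 ≤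
        ((0 : Fin (k + 1)) : ℕ) + 1 + (k + 1) * 1 by simp)
      rw [h1] at h2
      simpa using h2
  · rintro ⟨h, h'⟩
    refine antitone_int_of_succ_le fun j => ?_
    have hm := rep_mem k j
    rw [Finset.mem_Icc] at hm
    obtain ⟨i, q, rfl⟩ : ∃ (i : Fin (k + 1)) (q : ℤ), j = (i : ℤ) + 1 + (k + 1) * q := by
      refine ⟨⟨(rep k j - 1).toNat, by omega⟩, (j - 1) / (k + 1), ?_⟩
      have h2 : (((rep k j - 1).toNat : ℕ) : ℤ) + 1 = rep k j := by omega
      simp only [h2]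
      rw [rep_eq]
      ring
    rw [seqExtend_shift, seqExtend_coe]
    induction i using Fin.lastCases with
    | last =>
      have h1 : (((Fin.last k : Fin (k + 1)) : ℕ) : ℤ) + 1 + (k + 1) * q + 1 =
          ((0 : Fin (k + 1)) : ℕ) + 1 + (k + 1) * (q + 1) := by
        simp
        ring
      rw [h1, seqExtend_shift, seqExtend_coe]
      push_cast
      linarith
    | cast i =>
      have h1 : ((i.castSucc : ℕ) : ℤ) + 1 + (k + 1) * q + 1 =
          ((i.succ : Fin (k + 1)) : ℕ) + 1 + (k + 1) * q := by
        simp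
        ring
      rw [h1, seqExtend_shift, seqExtend_coe]
      linarith [h (Fin.castSucc_lt_succ (i := i)).le]

theorem toV_mem_fundAlcove {k : ℕ} (a : Fin (k + 1) → ℝ) :
    toV a ∈ fundAlcove k ↔ Antitone (seqExtend a) := by
  constructor
  · rintro ⟨b, hb, hba⟩
    obtain ⟨t, rfl⟩ := (toV_eq_iff a b).1 hba.symm
    intro i j hij
    have := (antitone_seqExtend_iff b).2 hb hij
    rw [seqExtend_add_const, seqExtend_add_const]
    linarith
  · exact fun h => ⟨a, (antitone_seqExtend_iff a).1 h, rfl⟩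

theorem toV_mem_alcove {k : ℕ} (w : affineSymm k) (a : Fin (k + 1) → ℝ) :
    toV a ∈ alcove w ↔ Antitone fun j => seqExtend a (w⁻¹.1 j) := by
  rw [← funext (seqExtend_diamond w a), ← toV_mem_fundAlcove, ← smul_toV]
  constructor
  · rintro ⟨v, hv, hva⟩
    rw [← hva]
    simpa using hv
  · exact fun h => ⟨_, h, by simp⟩

theorem exists_strictAnti_seqExtend (k : ℕ) :
    ∃ a : Fin (k + 1) → ℝ, StrictAnti (seqExtend a) := by
  have h0 : (0 : ℝ) < k + 1 := by positivity
  refine ⟨fun i => -((i : ℝ) + 1) / (k + 1), ?_⟩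
  rw [seqExtend_ext (f := fun j => -(j : ℝ) / (k + 1))]
  · intro i j hij
    have : (i : ℝ) < j := by exact_mod_cast hij
    simp only
    gcongr
  · intro j q
    push_cast
    field_simp
    ring
  · intro i
    push_cast
    rfl

theorem alcove_injective (k : ℕ) : Function.Injective (alcove (k := k)) := by
  intro y z h
  obtain ⟨a, ha⟩ := exists_strictAnti_seqExtend k
  have hy : toV (diamond y⁻¹ a) ∈ alcove y := by
    rw [toV_mem_alcove]
    simpa [seqExtend_diamond] using ha.antitone
  rw [h, toV_mem_alcove] at hy
  refine mul_inv_eq_one.1 (eq_one_of_monotone (y * z⁻¹) fun i j hij => ?_)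
  have h1 := hy hij
  simp only [seqExtend_diamond, inv_inv] at h1
  exact ha.le_iff_ge.1 h1

/-- Reading the place `j` of `a - γ` means reading the place `j_B⁻¹ (j + c)` of `a`, where `γ` is
the indicator vector of `B`. -/
theorem seqExtend_sub_indicator {k r c : ℕ} (h : r + c = k + 1)
    (B : {B : Finset (Fin (k + 1)) // B.card = c}) (a : Fin (k + 1) → ℝ) :
    seqExtend (a - fun i => if i ∈ B.1 then 1 else 0) =
      fun j => seqExtend a ((jElt h B)⁻¹.1 (j + c)) := by
  have hr : (r : ℤ) + c = k + 1 := by exact_mod_cast h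
  refine seqExtend_ext (fun j q => ?_) fun i => ?_
  · rw [add_right_comm, affineSymm_shift, seqExtend_shift]
  · have hw : (jElt h B).1 ((i : ℤ) + 1) = if i ∈ B.1 then (i : ℤ) + 1 - r else (i : ℤ) + 1 + c :=
      window_jElt h B i
    have h1 : (jElt h B)⁻¹.1 ((i : ℤ) + 1 + c) =
        (i : ℤ) + 1 + (k + 1) * (if i ∈ B.1 then 1 else 0) := by
      change (jElt h B).1⁻¹ _ = _
      rw [Equiv.Perm.inv_eq_iff_eq, affineSymm_shift, hw]
      split_ifs <;> linarith
    rw [h1, seqExtend_shift, seqExtend_coe]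
    simp

theorem isPseudoTranslation_jElt {k r c : ℕ} (h : r + c = k + 1)
    (B : {B : Finset (Fin (k + 1)) // B.card = c}) :
    IsPseudoTranslation (jElt h B) 1 (toV fun i => if i ∈ B.1 then 1 else 0) := by
  set g : Fin (k + 1) → ℝ := fun i => if i ∈ B.1 then 1 else 0
  ext v
  obtain ⟨a, rfl⟩ : ∃ a, toV a = v := Submodule.Quotient.mk_surjective _ v
  have h1 : toV a ∈ (fun v => v + toV g) '' alcove 1 ↔ toV (a - g) ∈ alcove 1 := by
    have h2 : toV (a - g) = toV a - toV g := rfl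
    rw [Set.image_add_right, Set.mem_preimage, h2, sub_eq_add_neg]
  rw [h1, mul_one, toV_mem_alcove, toV_mem_alcove]
  simp only [g, inv_one]
  change _ ↔ Antitone (seqExtend (a - fun i => if i ∈ B.1 then 1 else 0))
  rw [seqExtend_sub_indicator h]
  constructor
  · exact fun ha i j hij => ha (by omega)
  · intro ha i j hij
    simpa using ha (show i - c ≤ j - c by omega)

theorem IsPseudoTranslation.unique {k : ℕ} {y z : affineSymm k} {η : AlcoveSpace k}
    (hy : IsPseudoTranslation y 1 η) (hz : IsPseudoTranslation z 1 η) : y = z := by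
  have := hy.trans hz.symm
  rw [mul_one, mul_one] at this
  exact alcove_injective k this

theorem mem_Gam {k c : ℕ} (γ : AlcoveSpace k) :
    γ ∈ Gam k c ↔ ∃ B : {B : Finset (Fin (k + 1)) // B.card = c},
      (toV fun i => if i ∈ B.1 then 1 else 0) = γ := by
  classical
  simp only [Gam, Finset.mem_image, Finset.mem_filter, Fintype.mem_piFinset,
    Finset.mem_insert, Finset.mem_singleton]
  constructor
  · rintro ⟨a, ⟨h01, hsum⟩, rfl⟩
    have ha : (fun i => if i ∈ Finset.univ.filter (fun i => a i = 1) then (1 : ℝ) else 0) = a := by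
      funext i
      rcases h01 i with hi | hi <;> simp [hi]
    refine ⟨⟨Finset.univ.filter fun i => a i = 1, ?_⟩, by rw [ha]⟩
    rw [← ha, Finset.sum_ite_mem] at hsum
    simpa using hsum
  · rintro ⟨B, rfl⟩
    refine ⟨_, ⟨fun i => ?_, ?_⟩, rfl⟩
    · split_ifs <;> simp
    · rw [Finset.sum_ite_mem]
      simp [B.2]

/-- Two indicator vectors of sets of the same size that differ by a constant vector are equal:
summing the entries shows that the constant is `0`. -/
theorem toV_indicator_injective (k c : ℕ) :
    Function.Injective fun B : {B : Finset (Fin (k + 1)) // B.card = c} =>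
      (toV fun i => if i ∈ B.1 then 1 else 0 : AlcoveSpace k) := by
  intro B C hBC
  obtain ⟨t, ht⟩ := (toV_eq_iff _ _).1 hBC
  have ht' : ∀ i, (if i ∈ B.1 then (1 : ℝ) else 0) = (if i ∈ C.1 then 1 else 0) + t := congrFun ht
  have hsum := Finset.sum_congr (s₁ := Finset.univ) rfl fun i _ => ht' i
  rw [Finset.sum_add_distrib, Finset.sum_ite_mem, Finset.sum_ite_mem] at hsum
  simp only [Finset.univ_inter, Finset.sum_const, B.2, C.2, Finset.card_univ, Fintype.card_fin,
    left_eq_add, smul_eq_zero, Nat.succ_ne_zero, false_or] at hsum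
  ext i
  have hi := ht' i
  rw [hsum] at hi
  by_cases hB : i ∈ B.1 <;> by_cases hC : i ∈ C.1 <;> simp_all

theorem theorem3p18 (K : Type*) [CommRing K] (k r c : ℕ) [NeZero k]
    (hr : 1 ≤ r) (hc : 1 ≤ c) (h : r + c = k + 1) :
    (∀ γ ∈ Gam k c, ∃! y : affineSymm k, IsPseudoTranslation y 1 γ) ∧
      yRect K k c = wRect K h := by
  constructor
  · intro γ hγ
    obtain ⟨B, rfl⟩ := (mem_Gam γ).1 hγ
    exact ⟨jElt h B, isPseudoTranslation_jElt h B,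
      fun y hy => hy.unique (isPseudoTranslation_jElt h B)⟩
  · symm
    refine Finset.sum_bij (fun B _ => toV fun i => if i ∈ B.1 then 1 else 0)
      (fun B _ => (mem_Gam _).2 ⟨B, rfl⟩)
      (fun B _ C _ hBC => toV_indicator_injective k c hBC)
      (fun γ hγ => ?_) fun B _ => ?_
    · obtain ⟨B, hB⟩ := (mem_Gam γ).1 hγ
      exact ⟨B, Finset.mem_univ _, hB⟩
    · have hB := isPseudoTranslation_jElt h B
      exact congrArg (nilBasis K) (hB.unique (Classical.epsilon_spec
        (p := fun y => IsPseudoTranslation y 1 (toV fun i => if i ∈ B.1 then 1 else 0)) ⟨_, hB⟩))
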